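/- For $n\ge 0$ let $\mathfrak S_n$ be the set of permutations of $[n]=\{1,\dots,n\}$ (with $\mathfrak S_0$ consisting of the empty permutation). For $\sigma\in\mathfrak S_n$ let $\mathrm{exc}(\sigma)=|\{i:\sigma(i)>i\}|$ and $\mathrm{fix}(\sigma)=|\{i:\sigma(i)=i\}|$. Let $\overline\sigma$ be the word obtained from $\sigma(1)\cdots\sigma(n)$ by replacing $\sigma(i)$ with a barred letter $\overline{\sigma(i)}$ whenever $\sigma(i)>i$; order the letters by $\overline 1<\cdots<\overline n<1<\cdots<n$, and let $\mathrm{Exd}(\sigma)=\{i\in[n-1]:\overline\sigma_i>\overline\sigma_{i+1}\}$ be the descent set of $\overline\sigma$. For $S\subseteq[n-1]$ let $$F_{S,n}(\mathbf x)=\sum_{\substack{i_1\ge\cdots\ge i_n\ge1\\ j\in S\Rightarrow i_j>i_{j+1}}}x_{i_1}\cdots x_{i_n}\in\mathbb Q[[x_1,x_2,\dots]],\qquad F_{\emptyset,0}=1,$$ and put $$Q_{n,j,k}(\mathbf x)=\sum_{\substack{\sigma\in\mathfrak S_n\\ \mathrm{exc}(\sigma)=j,\ \mathrm{fix}(\sigma)=k}}F_{\mathrm{Exd}(\sigma),n}(\mathbf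 x).$$ Let $h_n=h_n(\mathbf x)$ be the complete homogeneous symmetric function of degree $n$ (the sum of all monomials of degree $n$ in $x_1,x_2,\dots$), let $H(z)=\sum_{n\ge0}h_nz^n$, and let $[m]_t=1+t+\cdots+t^{m-1}$. **Theorem.** In the ring of formal power series in $t,r,z$ over $\mathbb Q[[x_1,x_2,\dots]]$, the two denominators below are invertible and $$\sum_{n,j,k\ge0}Q_{n,j,k}(\mathbf x)\,t^jr^kz^n=\frac{(1-t)H(rz)}{H(tz)-tH(z)}=\frac{H(rz)}{1-\sum_{n\ge2}t[n-1]_t\,h_nz^n}.$$ -/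

import Mathlib

noncomputable section

namespace EulerianQSym

/-- Formal power series with rational coefficients in the variables `x₁, x₂, …`. -/
abbrev XSeries : Type := MvPowerSeries ℕ+ ℚ

/-- The content of a sequence `i₁, …, iₙ`: the exponent vector of the monomial
`x_{i₁} ⋯ x_{iₙ}`. -/
def content {n : ℕ} (s : Fin n → ℕ+) : ℕ+ →₀ ℕ := ∑ a, Finsupp.single (s a) 1

/-- The sequences `i₁ ≥ … ≥ iₙ ≥ 1` with `i_j > i_{j+1}` for all `j ∈ S`. A position `j`
in `{1, …, n}` corresponds to the element `j - 1` of `Fin n`. -/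
def IsCompatible {n : ℕ} (S : Set ℕ) (s : Fin n → ℕ+) : Prop :=
  Antitone s ∧ ∀ a b : Fin n, (b : ℕ) = (a : ℕ) + 1 → (a : ℕ) + 1 ∈ S → s b < s a

/-- Only finitely many sequences have a given content, so the cardinality in
`fundamental` is a genuine count. -/
theorem finite_compatible {n : ℕ} (S : Set ℕ) (m : ℕ+ →₀ ℕ) :
    {s : Fin n → ℕ+ | IsCompatible S s ∧ content s = m}.Finite := by
  refine (Set.Finite.pi' (fun _ : Fin n => m.support.finite_toSet)).subset ?_
  rintro s ⟨-, rfl⟩ a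
  simp only [Finset.mem_coe, Finsupp.mem_support_iff, content, Finsupp.finsetSum_apply]
  intro h
  have := (Finset.sum_eq_zero_iff.mp h) a (Finset.mem_univ a)
  simp at this

/-- The fundamental quasisymmetric function `F_{S,n}`, the sum of the monomials
`x_{i₁} ⋯ x_{iₙ}` over the sequences `i₁ ≥ … ≥ iₙ ≥ 1` with `i_j > i_{j+1}` for `j ∈ S`:
its coefficient at a monomial is the number of such sequences with that monomial. -/
def fundamental (S : Set ℕ) (n : ℕ) : XSeries :=
  fun m => (Set.ncard {s : Fin n → ℕ+ | IsCompatible S s ∧ content s = m} : ℚ)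

/-- The complete homogeneous symmetric function `hₙ`, the sum of all monomials of degree `n`. -/
def hsym (n : ℕ) : XSeries := fun m => if m.degree = n then 1 else 0

/-- The descent set `{j ∈ [n-1] : w_j > w_{j+1}}` of a word `w₁ … wₙ`
(positions are numbered from `1`). -/
def desSet {α : Type*} [LinearOrder α] {n : ℕ} (w : Fin n → α) : Set ℕ :=
  {j | ∃ a b : Fin n, (a : ℕ) + 1 = j ∧ (b : ℕ) = j ∧ w b < w a}

/-- The word `σ̄`, obtained from `σ₁ … σₙ` by barring `σᵢ` whenever `i` is an excedance
position. Barred letters are in the left summand and unbarred letters in the right summand of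
the lexicographic sum, so that `1̄ < … < n̄ < 1 < … < n`. -/
def barWord {n : ℕ} (σ : Equiv.Perm (Fin n)) : Fin n → Fin n ⊕ₗ Fin n :=
  fun i => if i < σ i then toLex (Sum.inl (σ i)) else toLex (Sum.inr (σ i))

/-- `Exd(σ) = Des(σ̄)`. -/
def exd {n : ℕ} (σ : Equiv.Perm (Fin n)) : Set ℕ := desSet (barWord σ)

/-- The number of excedances. -/
def exc {n : ℕ} (σ : Equiv.Perm (Fin n)) : ℕ := (Finset.univ.filter fun i => i < σ i).card

/-- The number of fixed points. -/
def fix {n : ℕ} (σ : Equiv.Perm (Fin n)) : ℕ := (Finset.univ.filter fun i => σ i = i).card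

/-- The fixed point Eulerian quasisymmetric function `Q_{n,j,k}`. -/
def Q (n j k : ℕ) : XSeries :=
  ∑ σ ∈ (Finset.univ : Finset (Equiv.Perm (Fin n))).filter (fun σ => exc σ = j ∧ fix σ = k),
    fundamental (exd σ) n

/-- Formal power series in `t, r` over `XSeries`. The ring of the generating functions is
`PowerSeries TRSeries`, its variable being `z`. -/
abbrev TRSeries : Type := MvPowerSeries (Fin 2) XSeries

/-- The variable `t`. -/
def t : TRSeries := MvPowerSeries.X 0

/-- The variable `r`. -/
def r : TRSeries := MvPowerSeries.X 1

/-- The series `∑_{n,j,k ≥ 0} Q_{n,j,k} t^j r^k z^n`. -/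
def genQ : PowerSeries TRSeries := PowerSeries.mk fun n e => Q n (e 0) (e 1)

/-- `H(z) = ∑_{n ≥ 0} hₙ zⁿ`. For `a` in `TRSeries`, `PowerSeries.rescale a H` is `H(az)`. -/
def H : PowerSeries TRSeries := PowerSeries.mk fun n => MvPowerSeries.C (hsym n)

/-- `[n]_t = 1 + t + ⋯ + t^(n-1)`. -/
def qnum (n : ℕ) : TRSeries := ∑ i ∈ Finset.range n, t ^ i

/-- `H(tz) - t H(z)`. -/
def den₁ : PowerSeries TRSeries := PowerSeries.rescale t H - PowerSeries.C t * H

/-- `1 - ∑_{n ≥ 2} t [n-1]_t hₙ zⁿ`. -/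
def den₂ : PowerSeries TRSeries :=
  1 - PowerSeries.mk fun n => if 2 ≤ n then t * qnum (n - 1) * MvPowerSeries.C (hsym n) else 0

end EulerianQSym

end

/-! Fix a monomial `x^m`. Only one weakly decreasing index sequence has this content, and its level
sets cut the positions into blocks. Hence `x^m` has coefficient 1 in `F_{Exd(σ),n}` if `σ̄`
increases along every block, and 0 otherwise (`coeff_fundamental`).

Encode such a `σ` by the word whose `v`-th letter is the block of `σ⁻¹ v`, barred if `σ⁻¹ v < v`.
Then `σ` is the stable sort of its word, barred letters count excedances, and the fixed points in
block `c` are the final run of unbarred letters `c` (`sum_blockIncreasing`). The words that occur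
are described by letter counts and by conditions inside single blocks, so the count is the
coefficient of `x^m` in a product of block polynomials `B_{c,m_c}` (`sum_blockIncreasing_eq_coeff`).

With `L_c` the sum of the letters admissible in `c`, one has `∑ B_{c,k} z^k = (1 - x_c z)(1 - t x_c
z) / ((1 - r x_c z)(1 - L_c z))`. Factors depending on `x_c z` alone can be pulled out of the
diagonal coefficient (`prodSeries_mul_diag`). What is left, the diagonal of the powers `L_c^k`, is a
case of MacMahon's master theorem and equals `(1 - t) / (∏(1 - x_c) - t ∏(1 - t x_c))`, by a
telescoping product (`diag_letterSum_mul`). In finitely many variables with `z = 1`, `H(az)` is `∏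
1/(1 - a x_c)`, and the first quotient results. The second follows from `den₁_eq_mul_den₂`. -/

noncomputable section

namespace EulerianQSym

/-! ### Diagonal coefficients of families of polynomials. -/

section Diagonal

variable {T R : Type*} [CommRing R]

/-- The convolution of the family `B` with the series `∑ i, g i * x ^ i`. -/
def conv (g : ℕ → R) (B : T → ℕ → MvPolynomial T R) (c : T) (k : ℕ) : MvPolynomial T R :=
  ∑ p ∈ Finset.HasAntidiagonal.antidiagonal k, MvPolynomial.C (g p.1) * MvPolynomial.X c ^ p.1 * B c p.2

theorem conv_eq_of_zero_one {g : ℕ → R} {a : R} (h0 : g 0 = 1) (h1 : g 1 = -a)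
    (h : ∀ k, g (k + 2) = 0) (B : T → ℕ → MvPolynomial T R) (c : T) (k : ℕ) :
    conv g B c (k + 1) = B c (k + 1) - MvPolynomial.C a * MvPolynomial.X c * B c k := by
  rw [conv, Finset.Nat.sum_antidiagonal_succ]
  cases k with
  | zero => simp [h0, h1]; ring
  | succ k =>
    rw [Finset.Nat.sum_antidiagonal_succ]
    simp only [zero_add, h, map_zero, zero_mul, Finset.sum_const_zero, h0, h1]
    simp; ring

theorem conv_zero {g : ℕ → R} (h0 : g 0 = 1) (B : T → ℕ → MvPolynomial T R) (c : T) :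
    conv g B c 0 = B c 0 := by
  simp [conv, h0]

theorem conv_pow_succ (a : R) (B : T → ℕ → MvPolynomial T R) (c : T) (k : ℕ) :
    conv (fun i => a ^ i) B c (k + 1) =
      MvPolynomial.C a * MvPolynomial.X c * conv (fun i => a ^ i) B c k + B c (k + 1) := by
  rw [conv, Finset.Nat.sum_antidiagonal_succ, conv, Finset.mul_sum, add_comm]
  congr 1
  · refine Finset.sum_congr rfl fun p _ => ?_
    simp only [pow_succ, map_mul]
    ring
  · simp

variable [Fintype T]
/-- The diagonal of a family `B`: its coefficient at `x^m` is the coefficient of `x^m` in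
`∏ c, B c (m c)`. -/
def diag (B : T → ℕ → MvPolynomial T R) : MvPowerSeries T R :=
  fun m => MvPolynomial.coeff m (∏ c, B c (m c))

/-- The product over all variables `x` of the series `∑ i, g i * x ^ i`. -/
def prodSeries (T : Type*) [Fintype T] (g : ℕ → R) : MvPowerSeries T R :=
  fun m => ∏ c, g (m c)

theorem coeff_diag (B : T → ℕ → MvPolynomial T R) (m : T →₀ ℕ) :
    MvPowerSeries.coeff m (diag B) = MvPolynomial.coeff m (∏ c, B c (m c)) := rfl

theorem coeff_prodSeries (g : ℕ → R) (m : T →₀ ℕ) :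
    MvPowerSeries.coeff m (prodSeries T g) = ∏ c, g (m c) := rfl

theorem prod_X_pow_eq_monomial (a : T →₀ ℕ) :
    ∏ c, (MvPolynomial.X c : MvPolynomial T R) ^ a c = MvPolynomial.monomial a 1 := by
  rw [MvPolynomial.monomial_eq, map_one, one_mul, Finsupp.prod_fintype _ _ (by simp)]

/-- Expanding `∏ c, conv g B c (m c)` chooses a splitting `m c = a c + b c` for each `c`, that is, a
splitting `m = a + b`. The chosen term carries the factor `x^a`, so its coefficient at `x^m` is that
of `∏ c, B c (b c)` at `x^b`. -/
theorem prodSeries_mul_diag (g : ℕ → R) (B : T → ℕ → MvPolynomial T R) :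
    prodSeries T g * diag B = diag (conv g B) := by
  classical
  ext m
  rw [MvPowerSeries.coeff_mul, coeff_diag]
  simp only [conv, Finset.prod_univ_sum, MvPolynomial.coeff_sum, coeff_diag, coeff_prodSeries]
  refine Finset.sum_bij' (fun p _ c => (p.1 c, p.2 c))
    (fun φ _ => (Finsupp.equivFunOnFinite.symm fun c => (φ c).1,
      Finsupp.equivFunOnFinite.symm fun c => (φ c).2)) ?_ ?_ ?_ ?_ ?_
  · rintro ⟨a, b⟩ h
    rw [Finset.HasAntidiagonal.mem_antidiagonal] at h
    simp [Fintype.mem_piFinset, ← h]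
  · intro φ h
    rw [Fintype.mem_piFinset] at h
    rw [Finset.HasAntidiagonal.mem_antidiagonal]
    ext c
    simpa using h c
  · rintro ⟨a, b⟩ h
    ext <;> simp
  · intro φ h
    ext <;> simp
  · rintro ⟨a, b⟩ h
    rw [Finset.HasAntidiagonal.mem_antidiagonal] at h
    subst h
    simp only [Finset.prod_mul_distrib, prod_X_pow_eq_monomial, ← map_prod]
    rw [mul_assoc, MvPolynomial.coeff_C_mul, MvPolynomial.coeff_monomial_mul, one_mul]

/-- The coefficients of `1 - a * x`. -/
def linCoeff (a : R) : ℕ → R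
  | 0 => 1
  | 1 => -a
  | _ + 2 => 0

/-- `∏ c, 1 / (1 - a * x_c)`. -/
def geomSeries (T : Type*) [Fintype T] (a : R) : MvPowerSeries T R := prodSeries T fun i => a ^ i

/-- `∏ c, (1 - a * x_c)`. -/
def linSeries (T : Type*) [Fintype T] (a : R) : MvPowerSeries T R := prodSeries T (linCoeff a)

theorem geomSeries_mul_linSeries (a : R) : geomSeries T a * linSeries T a = 1 := by
  classical
  have h1 : linSeries T a = diag fun c k => MvPolynomial.C (linCoeff a k) * MvPolynomial.X c ^ k := by
    ext m
    rw [coeff_diag, Finset.prod_mul_distrib, prod_X_pow_eq_monomial, ← map_prod,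
      MvPolynomial.coeff_C_mul, MvPolynomial.coeff_monomial, if_pos rfl, mul_one]
    rfl
  have h2 : ∀ (c : T) (k : ℕ), conv (fun i => a ^ i)
      (fun c k => MvPolynomial.C (linCoeff a k) * MvPolynomial.X c ^ k) c (k + 1) = 0 := by
    intro c k
    induction k with
    | zero => rw [conv_pow_succ, conv_zero (pow_zero a)]; simp [linCoeff]
    | succ k ih => rw [conv_pow_succ, ih]; simp [linCoeff]
  rw [geomSeries, h1, prodSeries_mul_diag]
  ext m
  rw [coeff_diag, MvPowerSeries.coeff_one]
  split_ifs with hm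
  · subst hm
    simp [conv_zero, linCoeff]
  · obtain ⟨c, hc⟩ := Finsupp.ne_iff.mp hm
    obtain ⟨k, hk⟩ := Nat.exists_eq_succ_of_ne_zero hc
    rw [Finset.prod_eq_zero (Finset.mem_univ c) (by rw [hk]; exact h2 c k), MvPolynomial.coeff_zero]

end Diagonal

/-! ### The master theorem for the letter sums, and the block polynomials. -/

section Master

variable {T : Type*} [LinearOrder T]

/-- For `c₁ < … < c_k` in `S` put `y_i = t(x₁ + … + x_i) + (x_{i+1} + … + x_k) + u`. The identity is
`y₀ · (y₁ ⋯ y_k) = y_k · (y₀ ⋯ y_{k-1})`. When the maximum `M` is removed, `x M` stays with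
coefficient 1 in all remaining factors, so it is absorbed into `u`. -/
theorem telescope_aux {A : Type*} [CommRing A] (t : A) (x : T → A) (S : Finset T) (u : A) :
    (∑ d ∈ S, x d + u) *
        ∏ c ∈ S, (t * ∑ d ∈ S with d ≤ c, x d + ∑ d ∈ S with c < d, x d + u) =
      (t * ∑ d ∈ S, x d + u) *
        ∏ c ∈ S, (t * ∑ d ∈ S with d < c, x d + ∑ d ∈ S with c ≤ d, x d + u) := by
  induction S using Finset.induction_on_max generalizing u with
  | empty => simp
  | insert M S hM ih =>
    have hMS : M ∉ S := fun h => lt_irrefl _ (hM M h)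
    rw [Finset.prod_insert hMS, Finset.prod_insert hMS, Finset.sum_insert hMS]
    have e1 : (insert M S).filter (fun d => d ≤ M) = insert M S := by
      refine Finset.filter_true_of_mem fun d hd => ?_
      rcases Finset.mem_insert.1 hd with rfl | hd
      exacts [le_rfl, (hM d hd).le]
    have e2 : (insert M S).filter (fun d => M < d) = ∅ := by
      refine Finset.filter_false_of_mem fun d hd => ?_
      rcases Finset.mem_insert.1 hd with rfl | hd
      exacts [lt_irrefl _, (hM d hd).not_gt]
    have e3 : (insert M S).filter (fun d => d < M) = S := by
      rw [Finset.filter_insert, if_neg (lt_irrefl M), Finset.filter_true_of_mem hM]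
    have e4 : (insert M S).filter (fun d => M ≤ d) = {M} := by
      rw [Finset.filter_insert, if_pos le_rfl,
        Finset.filter_false_of_mem fun d hd => (hM d hd).not_ge]
      rfl
    rw [e1, e2, e3, e4, Finset.sum_insert hMS, Finset.sum_empty, Finset.sum_singleton]
    have p1 : ∏ c ∈ S, (t * ∑ d ∈ insert M S with d ≤ c, x d +
          ∑ d ∈ insert M S with c < d, x d + u) =
        ∏ c ∈ S, (t * ∑ d ∈ S with d ≤ c, x d + ∑ d ∈ S with c < d, x d + (u + x M)) := by
      refine Finset.prod_congr rfl fun c hc => ?_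
      rw [Finset.filter_insert, if_neg (hM c hc).not_ge, Finset.filter_insert, if_pos (hM c hc),
        Finset.sum_insert (by simp [hMS])]
      ring
    have p2 : ∏ c ∈ S, (t * ∑ d ∈ insert M S with d < c, x d +
          ∑ d ∈ insert M S with c ≤ d, x d + u) =
        ∏ c ∈ S, (t * ∑ d ∈ S with d < c, x d + ∑ d ∈ S with c ≤ d, x d + (u + x M)) := by
      refine Finset.prod_congr rfl fun c hc => ?_
      rw [Finset.filter_insert, if_neg (hM c hc).not_gt, Finset.filter_insert,
        if_pos (hM c hc).le, Finset.sum_insert (by simp [hMS])]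
      ring
    rw [p1, p2]
    linear_combination (t * (x M + ∑ d ∈ S, x d) + u) * ih (u + x M)

/-- For `u = 0` one has `y_k = t y₀`. Splitting off the factor at the maximum gives the relation
without cancelling `y₀`. -/
theorem telescope {A : Type*} [CommRing A] (t : A) (x : T → A) {S : Finset T} (hS : S.Nonempty) :
    ∏ c ∈ S, (t * ∑ d ∈ S with d ≤ c, x d + ∑ d ∈ S with c < d, x d) =
      t * ∏ c ∈ S, (t * ∑ d ∈ S with d < c, x d + ∑ d ∈ S with c ≤ d, x d) := by
  obtain ⟨M, S, hM, rfl⟩ : ∃ M S', (∀ d ∈ S', d < M) ∧ S = insert M S' :=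
    ⟨S.max' hS, S.erase (S.max' hS), fun d hd => S.lt_max'_of_mem_erase_max' hS hd,
      (Finset.insert_erase (S.max'_mem hS)).symm⟩
  have hMS : M ∉ S := fun h => lt_irrefl _ (hM M h)
  rw [Finset.prod_insert hMS, Finset.prod_insert hMS]
  have e1 : (insert M S).filter (fun d => d ≤ M) = insert M S := by
    refine Finset.filter_true_of_mem fun d hd => ?_
    rcases Finset.mem_insert.1 hd with rfl | hd
    exacts [le_rfl, (hM d hd).le]
  have e2 : (insert M S).filter (fun d => M < d) = ∅ := by
    refine Finset.filter_false_of_mem fun d hd => ?_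
    rcases Finset.mem_insert.1 hd with rfl | hd
    exacts [lt_irrefl _, (hM d hd).not_gt]
  have e3 : (insert M S).filter (fun d => d < M) = S := by
    rw [Finset.filter_insert, if_neg (lt_irrefl M), Finset.filter_true_of_mem hM]
  have e4 : (insert M S).filter (fun d => M ≤ d) = {M} := by
    rw [Finset.filter_insert, if_pos le_rfl,
      Finset.filter_false_of_mem fun d hd => (hM d hd).not_ge]
    rfl
  rw [e1, e2, e3, e4, Finset.sum_insert hMS, Finset.sum_empty, Finset.sum_singleton]
  have p1 : ∏ c ∈ S, (t * ∑ d ∈ insert M S with d ≤ c, x d + ∑ d ∈ insert M S with c < d, x d) =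
      ∏ c ∈ S, (t * ∑ d ∈ S with d ≤ c, x d + ∑ d ∈ S with c < d, x d + x M) := by
    refine Finset.prod_congr rfl fun c hc => ?_
    rw [Finset.filter_insert, if_neg (hM c hc).not_ge, Finset.filter_insert, if_pos (hM c hc),
      Finset.sum_insert (by simp [hMS])]
    ring
  have p2 : ∏ c ∈ S, (t * ∑ d ∈ insert M S with d < c, x d + ∑ d ∈ insert M S with c ≤ d, x d) =
      ∏ c ∈ S, (t * ∑ d ∈ S with d < c, x d + ∑ d ∈ S with c ≤ d, x d + x M) := by
    refine Finset.prod_congr rfl fun c hc => ?_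
    rw [Finset.filter_insert, if_neg (hM c hc).not_gt, Finset.filter_insert,
      if_pos (hM c hc).le, Finset.sum_insert (by simp [hMS])]
    ring
  rw [p1, p2]
  linear_combination t * telescope_aux t x S (x M)

variable {R : Type*} [CommRing R]

/-- The specialization `x_d = 0` for `d ∉ S`. -/
def killOutside (S : Finset T) : MvPolynomial T R →ₐ[R] MvPolynomial T R :=
  MvPolynomial.aeval fun d => if d ∈ S then MvPolynomial.X d else 0

/-- Monomials with a variable outside the support of `m` do not affect the coefficient at `m`. This
shrinks the sums over all of `T` in the letter sums to sums over the support, as `telescope`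
requires. -/
theorem coeff_killOutside (m : T →₀ ℕ) (p : MvPolynomial T R) :
    MvPolynomial.coeff m (killOutside m.support p) = MvPolynomial.coeff m p := by
  induction p using MvPolynomial.induction_on' with
  | add p q hp hq => simp [hp, hq]
  | monomial a b =>
    rw [killOutside, MvPolynomial.aeval_monomial, MvPolynomial.algebraMap_eq,
      MvPolynomial.coeff_C_mul, MvPolynomial.coeff_monomial]
    by_cases h : a.support ⊆ m.support
    · have : (a.prod fun i k => (if i ∈ m.support then (MvPolynomial.X i : MvPolynomial T R)
          else 0) ^ k) = MvPolynomial.monomial a 1 := by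
        rw [MvPolynomial.monomial_eq, map_one, one_mul]
        exact Finsupp.prod_congr fun i hi => by rw [if_pos (h hi)]
      rw [this, MvPolynomial.coeff_monomial]
      simp
    · obtain ⟨i, hi, hi'⟩ := Finset.not_subset.1 h
      rw [Finsupp.prod, Finset.prod_eq_zero hi, MvPolynomial.coeff_zero, mul_zero, if_neg]
      · rintro rfl
        exact hi' hi
      · rw [if_neg hi', zero_pow (Finsupp.mem_support_iff.1 hi)]

variable [Fintype T]

/-- The sum of the letters admissible in the block `c`. -/
def letterSum (t : R) (c : T) : MvPolynomial T R :=
  MvPolynomial.C t * ∑ d with d ≤ c, MvPolynomial.X d + ∑ d with c ≤ d, MvPolynomial.X d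

theorem letterSum_sub_X (t : R) (c : T) :
    letterSum t c - MvPolynomial.X c =
      MvPolynomial.C t * ∑ d with d ≤ c, MvPolynomial.X d + ∑ d with c < d, MvPolynomial.X d := by
  have : (Finset.univ.filter fun d => c ≤ d) = insert c (Finset.univ.filter fun d => c < d) := by
    ext d; simp [le_iff_eq_or_lt, eq_comm]
  rw [letterSum, this, Finset.sum_insert (by simp)]
  ring

theorem letterSum_sub_C_mul_X (t : R) (c : T) :
    letterSum t c - MvPolynomial.C t * MvPolynomial.X c =
      MvPolynomial.C t * ∑ d with d < c, MvPolynomial.X d + ∑ d with c ≤ d, MvPolynomial.X d := by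
  have : (Finset.univ.filter fun d => d ≤ c) = insert c (Finset.univ.filter fun d => d < c) := by
    ext d; simp [le_iff_eq_or_lt]
  rw [letterSum, this, Finset.sum_insert (by simp)]
  ring

theorem killOutside_sum (S : Finset T) (p : T → Prop) [DecidablePred p] :
    killOutside S (∑ d with p d, (MvPolynomial.X d : MvPolynomial T R)) =
      ∑ d ∈ S with p d, MvPolynomial.X d := by
  rw [map_sum]
  simp only [killOutside, MvPolynomial.aeval_X]
  rw [← Finset.sum_filter, Finset.filter_filter]
  congr 1
  ext d
  simp [and_comm]

/-- The instance of MacMahon's master theorem for the matrix of the letters admissible in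
the blocks. -/
theorem diag_letterSum_mul (t : R) :
    (linSeries T 1 - MvPowerSeries.C t * linSeries T t) * diag (fun c k => letterSum t c ^ k) =
      MvPowerSeries.C (1 - t) := by
  -- Multiplying by `1 - a x_c` turns `L_c^k` into `L_c^(k-1) (L_c - a x_c)` for `k ≥ 1` and leaves
  -- 1 for `k = 0`; only blocks in the support of `m` contribute.
  have key : ∀ a : R, ∀ m : T →₀ ℕ,
      ∏ c, conv (linCoeff a) (fun c k => letterSum t c ^ k) c (m c) =
      (∏ c ∈ m.support, (letterSum t c - MvPolynomial.C a * MvPolynomial.X c)) *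
        ∏ c ∈ m.support, letterSum t c ^ (m c - 1) := by
    intro a m
    rw [← Finset.prod_mul_distrib]
    symm
    apply Finset.prod_subset_one_on_sdiff (Finset.subset_univ _)
    · intro c hc
      have : m c = 0 := by simpa using hc
      rw [this, conv_zero rfl, pow_zero]
    · intro c hc
      obtain ⟨k, hk⟩ := Nat.exists_eq_succ_of_ne_zero (Finsupp.mem_support_iff.1 hc)
      rw [hk, Nat.succ_eq_add_one, conv_eq_of_zero_one (a := a) rfl rfl fun _ => rfl,
        Nat.add_sub_cancel]
      ring
  rw [sub_mul, mul_assoc, linSeries, linSeries, prodSeries_mul_diag, prodSeries_mul_diag]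
  ext m
  rw [map_sub, MvPowerSeries.coeff_C_mul, coeff_diag, coeff_diag, key, key,
    MvPowerSeries.coeff_C]
  split_ifs with hm
  · subst hm; simp
  · rw [← MvPolynomial.coeff_C_mul, ← MvPolynomial.coeff_sub, ← coeff_killOutside]
    simp only [map_sub, map_mul, map_prod, map_one, one_mul]
    have h1 : ∀ c, killOutside m.support (letterSum t c) - killOutside m.support
        (MvPolynomial.X c) = MvPolynomial.C t * ∑ d ∈ m.support with d ≤ c, MvPolynomial.X d +
          ∑ d ∈ m.support with c < d, MvPolynomial.X d := by
      intro c
      rw [← map_sub, letterSum_sub_X, map_add, map_mul, killOutside_sum, killOutside_sum]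
      simp [killOutside]
    have h2 : ∀ c, killOutside m.support (letterSum t c) - killOutside m.support
        (MvPolynomial.C t) * killOutside m.support (MvPolynomial.X c) =
        MvPolynomial.C t * ∑ d ∈ m.support with d < c, MvPolynomial.X d +
          ∑ d ∈ m.support with c ≤ d, MvPolynomial.X d := by
      intro c
      rw [← map_mul, ← map_sub, letterSum_sub_C_mul_X, map_add, map_mul, killOutside_sum,
        killOutside_sum]
      simp [killOutside]
    have hC : killOutside m.support (MvPolynomial.C t) = MvPolynomial.C t := by
      simp [killOutside]
    simp only [h1, h2]
    -- For `m ≠ 0` the products of `L_c - x_c` and of `L_c - t x_c` over the support differ by the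
    -- factor `t`, so the two terms cancel.
    rw [telescope _ _ (Finsupp.support_nonempty_iff.2 hm), hC, mul_assoc, sub_self,
      MvPolynomial.coeff_zero]

/-- The generating polynomials of the words of length `k` in the block `c`, where `r` marks the
letters of the maximal suffix of unbarred letters `c`. -/
def blockPoly (t r : R) (c : T) : ℕ → MvPolynomial T R
  | 0 => 1
  | 1 => MvPolynomial.C r * MvPolynomial.X c +
      (letterSum t c - MvPolynomial.C t * MvPolynomial.X c - MvPolynomial.X c)
  | k + 2 => MvPolynomial.C r * MvPolynomial.X c * blockPoly t r c (k + 1) +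
      (letterSum t c - MvPolynomial.C t * MvPolynomial.X c) * letterSum t c ^ k *
        (letterSum t c - MvPolynomial.X c)

/-- Blockwise this is the rational form of `∑ B_{c,k} z^k`. The factor `1 / (1 - r x_c z)` is
matched through the recursion `conv_pow_succ`. -/
theorem diag_blockPoly (t r : R) :
    diag (blockPoly t r) = geomSeries T r *
      (linSeries T 1 * (linSeries T t * diag fun c k => letterSum t c ^ k)) := by
  rw [geomSeries, linSeries, linSeries, prodSeries_mul_diag, prodSeries_mul_diag,
    prodSeries_mul_diag]
  congr 1
  ext1 c
  ext1 k
  have h1 : ∀ (a : R) (B : T → ℕ → MvPolynomial T R) (c : T) (k : ℕ),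
    conv (linCoeff a) B c (k + 1) = B c (k + 1) - MvPolynomial.C a * MvPolynomial.X c * B c k :=
    fun a => conv_eq_of_zero_one rfl rfl fun _ => rfl
  have h0 : ∀ (a : R) (B : T → ℕ → MvPolynomial T R) (c : T),
    conv (linCoeff a) B c 0 = B c 0 := fun a => conv_zero rfl
  induction k with
  | zero => rw [conv_zero (pow_zero r), h0, h0]; simp [blockPoly]
  | succ k ih =>
    rw [conv_pow_succ, ← ih, h1, h1]
    cases k with
    | zero => rw [h0]; simp [blockPoly]
    | succ k =>
      rw [h1]
      simp only [blockPoly, map_one]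
      ring

theorem diag_blockPoly_mul (t r : R) :
    diag (blockPoly t r) * (geomSeries T t - MvPowerSeries.C t * geomSeries T 1) =
      MvPowerSeries.C (1 - t) * geomSeries T r := by
  rw [diag_blockPoly]
  linear_combination geomSeries T r * diag_letterSum_mul (T := T) t +
    geomSeries T r * linSeries T 1 * (diag fun c k => letterSum t c ^ k) *
      geomSeries_mul_linSeries (T := T) t - MvPowerSeries.C t * geomSeries T r * linSeries T t *
        (diag fun c k => letterSum t c ^ k) * geomSeries_mul_linSeries (T := T) (1 : R)

end Master

/-! ### Permutations with increasing blocks as words. -/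

section Words

variable {T : Type*} {n : ℕ}

/-- The word whose `v`-th letter is the block of `σ⁻¹ v`, with `false` for a barred and `true`
for an unbarred letter. -/
def blockWord (s : Fin n → T) (σ : Equiv.Perm (Fin n)) (v : Fin n) : T × Bool :=
  (s (σ.symm v), decide (¬ σ.symm v < v))

theorem blockWord_apply (s : Fin n → T) (σ : Equiv.Perm (Fin n)) (i : Fin n) :
    blockWord s σ (σ i) = (s i, decide (¬ i < σ i)) := by
  simp [blockWord]

variable [LinearOrder T]

/-- Equal fibres give equally many arguments with value at most `c`, for every `c`. If `u a < v a`,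
then by monotonicity `{v ≤ u a}` is strictly contained in `{u ≤ u a}`, since `a` lies only in the
latter. -/
theorem monotone_eq_of_card_fiber_eq {X : Type*} [Fintype X] [LinearOrder X] {f g : X → T}
    (hf : Monotone f) (hg : Monotone g)
    (h : ∀ c, (Finset.univ.filter fun a => f a = c).card = (Finset.univ.filter fun a => g a = c).card) :
    f = g := by
  classical
  have hcard : ∀ c, (Finset.univ.filter fun a => f a ≤ c).card =
      (Finset.univ.filter fun a => g a ≤ c).card := by
    intro c
    have aux : ∀ u : X → T, (∀ a, u a ∈ Finset.univ.image f ∪ Finset.univ.image g) →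
        (Finset.univ.filter fun a => u a ≤ c).card =
        ∑ d ∈ (Finset.univ.image f ∪ Finset.univ.image g).filter (· ≤ c),
          (Finset.univ.filter fun a => u a = d).card := by
      intro u hu
      rw [Finset.card_eq_sum_card_fiberwise (f := u)
        (t := (Finset.univ.image f ∪ Finset.univ.image g).filter (· ≤ c))]
      · refine Finset.sum_congr rfl fun d hd => ?_
        congr 1
        ext a
        simp only [Finset.mem_filter, Finset.mem_univ, true_and, and_iff_right_iff_imp]
        rintro rfl
        exact (Finset.mem_filter.1 hd).2
      · intro a ha
        simp only [Finset.coe_filter, Finset.mem_univ, true_and, Set.mem_ofPred_eq] at ha ⊢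
        exact ⟨hu a, ha⟩
    rw [aux f (by simp), aux g (by simp)]
    exact Finset.sum_congr rfl fun d _ => h d
  have hle : ∀ u v : X → T, Monotone u → Monotone v →
      (∀ c, (Finset.univ.filter fun a => u a ≤ c).card =
        (Finset.univ.filter fun a => v a ≤ c).card) → ∀ a, v a ≤ u a := by
    intro u v hu hv huv a
    by_contra! hlt
    have hss : (Finset.univ.filter fun b => v b ≤ u a) ⊂ (Finset.univ.filter fun b => u b ≤ u a) := by
      rw [Finset.ssubset_iff_of_subset]
      · exact ⟨a, by simp, by simpa using hlt⟩
      · intro b hb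
        simp only [Finset.mem_filter, Finset.mem_univ, true_and] at hb ⊢
        exact hu (le_of_not_ge fun hab => absurd ((hv hab).trans hb) hlt.not_ge)
    exact (Finset.card_lt_card hss).ne (huv (u a)).symm
  funext a
  exact le_antisymm (hle g f hg hf (fun c => (hcard c).symm) a) (hle f g hf hg hcard a)

/-- The word `σ̄` increases along every block of `s`. -/
def BlockIncreasing (s : Fin n → T) (σ : Equiv.Perm (Fin n)) : Prop :=
  ∀ i j, i < j → s i = s j → barWord σ i < barWord σ j

/-- A letter of the block `c` is admissible if it is barred and at most `c`, or unbarred and at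
least `c`. -/
def Admissible (c : T) (l : T × Bool) : Prop := if l.2 then c ≤ l.1 else l.1 ≤ c

/-- All letters are admissible, and no block `c` begins with the barred letter `c`. -/
def LocallyGood (s : Fin n → T) (w : Fin n → T × Bool) : Prop :=
  ∀ v, Admissible (s v) (w v) ∧ ((∀ u < v, s u ≠ s v) → w v ≠ (s v, false))

/-- The number of occurrences of each letter in `w`, barred or not, is the size of its block. -/
def Balanced (s : Fin n → T) (w : Fin n → T × Bool) : Prop :=
  ∀ c, (Finset.univ.filter fun v => (w v).1 = c).card = (Finset.univ.filter fun v => s v = c).card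

/-- The stable sorting permutation of the letters of `w`. -/
def sortPerm (w : Fin n → T × Bool) : Equiv.Perm (Fin n) :=
  Tuple.sort fun v => toLex (w v)

/-- Inside a block, `σ̄` lists the barred values in increasing order and then the unbarred ones.
Since `(c, false) < (c, true)`, this is the order in which a stable sort visits the positions of the
letters `c`. -/
theorem blockIncreasing_iff {s : Fin n → T} (hs : Monotone s) (σ : Equiv.Perm (Fin n)) :
    BlockIncreasing s σ ↔ sortPerm (blockWord s σ) = σ := by
  rw [eq_comm, sortPerm, Tuple.eq_sort_iff]
  have hbar : ∀ i j, s i = s j → (barWord σ i < barWord σ j ↔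
      (toLex (blockWord s σ (σ i)) < toLex (blockWord s σ (σ j)) ∨
        toLex (blockWord s σ (σ i)) = toLex (blockWord s σ (σ j)) ∧ σ i < σ j)) := by
    intro i j hij
    simp only [blockWord_apply, barWord, hij, Prod.Lex.toLex_lt_toLex, EmbeddingLike.apply_eq_iff_eq,
      Prod.mk.injEq, lt_irrefl, true_and, false_or]
    by_cases h1 : i < σ i <;> by_cases h2 : j < σ j <;> simp [h1, h2]
  constructor
  · intro h
    refine ⟨?_, ?_⟩
    · intro i j hij
      rcases hij.eq_or_lt with rfl | hlt
      · exact le_rfl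
      rcases (hs hij).lt_or_eq with hl | he
      · simp only [Function.comp, blockWord_apply]
        exact (Prod.Lex.toLex_lt_toLex.2 (Or.inl hl)).le
      · rcases (hbar i j he).1 (h i j hlt he) with h | h
        exacts [h.le, h.1.le]
    · intro i j hij he
      have hse : s i = s j := by
        simp only [blockWord_apply, EmbeddingLike.apply_eq_iff_eq, Prod.mk.injEq] at he
        exact he.1
      rcases (hbar i j hse).1 (h i j hij hse) with h | h
      exacts [absurd he h.ne, h.2]
  · rintro ⟨hm, hst⟩ i j hij he
    rw [hbar i j he]
    rcases (hm hij.le).lt_or_eq with h | h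
    exacts [Or.inl h, Or.inr ⟨h, hst i j hij h⟩]

theorem balanced_blockWord (s : Fin n → T) (σ : Equiv.Perm (Fin n)) :
    Balanced s (blockWord s σ) := by
  intro c
  refine Finset.card_bij (fun v _ => σ.symm v) ?_ ?_ ?_
  · intro v hv
    simpa [blockWord] using hv
  · intro a _ b _ h
    exact σ.symm.injective h
  · intro i hi
    exact ⟨σ i, by simpa [blockWord] using hi, by simp⟩

/-- Admissibility is monotonicity of `s` applied to `i < σ i` or `σ i ≤ i`. A barred letter `c` at
the start of block `c` would need an earlier position in the same block. -/
theorem locallyGood_blockWord {s : Fin n → T} (hs : Monotone s) (σ : Equiv.Perm (Fin n)) :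
    LocallyGood s (blockWord s σ) := by
  intro v
  obtain ⟨i, rfl⟩ := σ.surjective v
  rw [blockWord_apply]
  refine ⟨?_, ?_⟩
  · by_cases h : i < σ i
    · simpa [Admissible, h] using hs h.le
    · simpa [Admissible, h] using hs (not_lt.1 h)
  · intro hfirst heq
    simp only [Prod.mk.injEq, decide_eq_false_iff_not, not_not] at heq
    exact hfirst i heq.2 heq.1

theorem fst_sortPerm {s : Fin n → T} (hs : Monotone s) {w : Fin n → T × Bool}
    (hb : Balanced s w) (i : Fin n) : (w (sortPerm w i)).1 = s i := by
  have hm : Monotone fun i => (w (sortPerm w i)).1 := by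
    intro i j hij
    exact Prod.Lex.monotone_fst_ofLex (Tuple.monotone_sort (fun v => toLex (w v)) hij)
  refine congrFun (monotone_eq_of_card_fiber_eq hm hs fun c => ?_) i
  rw [← hb c]
  refine Finset.card_bij (fun i _ => sortPerm w i) ?_ ?_ ?_
  · intro v hv
    simpa using hv
  · intro a _ b _ h
    exact (sortPerm w).injective h
  · intro i hi
    exact ⟨(sortPerm w).symm i, by simpa using hi, by simp⟩

theorem snd_sortPerm_le {s : Fin n → T} (hs : Monotone s) {w : Fin n → T × Bool}
    (hb : Balanced s w) {i j : Fin n} (hij : i ≤ j) (h : s i = s j) :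
    (w (sortPerm w i)).2 ≤ (w (sortPerm w j)).2 := by
  have := Tuple.monotone_sort (fun v => toLex (w v)) hij
  simp only [Function.comp] at this
  change toLex (w (sortPerm w i)) ≤ toLex (w (sortPerm w j)) at this
  rw [Prod.Lex.toLex_le_toLex, fst_sortPerm hs hb, fst_sortPerm hs hb] at this
  exact (this.resolve_left h.not_lt).2

theorem sortPerm_lt {s : Fin n → T} (hs : Monotone s) {w : Fin n → T × Bool}
    (hb : Balanced s w) {i j : Fin n} (hij : i < j) (h : s i = s j)
    (h2 : (w (sortPerm w i)).2 = (w (sortPerm w j)).2) : sortPerm w i < sortPerm w j := by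
  refine (Tuple.eq_sort_iff.1 (rfl : sortPerm w = Tuple.sort fun v => toLex (w v))).2 i j hij ?_
  rw [EmbeddingLike.apply_eq_iff_eq]
  exact Prod.ext (by rw [fst_sortPerm hs hb, fst_sortPerm hs hb, h]) h2

/-- Let `σ` be the sorting permutation and suppose `σ i ≤ i`. Admissibility puts `σ i` and `i` in
one block. If `σ i < i`, induction gives `σ i < σ (σ i)`, contradicting that `σ` increases on the
barred letters of the block. If `σ i = i`, the condition on first letters gives a predecessor `u` in
the block, and `u < σ u < i` is impossible. -/
theorem lt_sortPerm_of_barred {s : Fin n → T} (hs : Monotone s) {w : Fin n → T × Bool}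
    (hb : Balanced s w) (hg : LocallyGood s w) (i : Fin n)
    (h : (w (sortPerm w i)).2 = false) : i < sortPerm w i := by
  induction i using WellFoundedLT.induction with
  | ind i ih =>
  by_contra! hle
  have hadm : ∀ j, (w (sortPerm w j)).2 = false → s j ≤ s (sortPerm w j) := by
    intro j hj
    have := (hg (sortPerm w j)).1
    rwa [Admissible, hj, if_neg (by simp), fst_sortPerm hs hb] at this
  have hc : s (sortPerm w i) = s i := le_antisymm (hs hle) (hadm i h)
  have hbar : ∀ u, u ≤ i → s u = s i → (w (sortPerm w u)).2 = false := fun u hu hsu => by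
    have := snd_sortPerm_le hs hb hu hsu
    rw [h] at this
    exact le_bot_iff.1 this
  rcases hle.lt_or_eq with hlt | heq
  · have h1 := hbar _ hle hc
    have h2 := ih _ hlt h1
    have h3 := sortPerm_lt hs hb hlt hc (h1.trans h.symm)
    exact h2.not_gt h3
  · have hne : ¬ ∀ u < i, s u ≠ s i := fun hf => by
      have := (hg i).2 hf
      apply this
      conv_lhs => rw [← heq]
      exact Prod.ext (fst_sortPerm hs hb i) h
    push Not at hne
    obtain ⟨u, ⟨hui, hsu⟩, hmax⟩ := Finset.exists_max_image
      (Finset.univ.filter fun u => u < i ∧ s u = s i) id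
      (by obtain ⟨u, hu⟩ := hne; exact ⟨u, by simpa using hu⟩) |>.imp fun u hu =>
        (⟨by simpa using hu.1, hu.2⟩ : (u < i ∧ s u = s i) ∧ _)
    have h1 := hbar u hui.le hsu
    have h2 := ih u hui h1
    have h3 := sortPerm_lt hs hb hui hsu (h1.trans h.symm)
    rw [heq] at h3
    have h4 : s (sortPerm w u) = s i :=
      le_antisymm (hs h3.le) (hsu ▸ hs h2.le)
    exact (hmax (sortPerm w u) (by simp [h3, h4])).not_gt h2

/-- If `i < σ i`, both lie in one block and the letter sorted to place `σ i` is unbarred too.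
Downward induction gives `σ (σ i) ≤ σ i`, against stability. -/
theorem sortPerm_le_of_unbarred {s : Fin n → T} (hs : Monotone s) {w : Fin n → T × Bool}
    (hb : Balanced s w) (hg : LocallyGood s w) (i : Fin n)
    (h : (w (sortPerm w i)).2 = true) : sortPerm w i ≤ i := by
  induction i using WellFoundedGT.induction with
  | ind i ih =>
  by_contra! hlt
  have hadm : ∀ j, (w (sortPerm w j)).2 = true → s (sortPerm w j) ≤ s j := by
    intro j hj
    have := (hg (sortPerm w j)).1
    rwa [Admissible, hj, if_pos rfl, fst_sortPerm hs hb] at this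
  have hc : s i = s (sortPerm w i) := le_antisymm (hs hlt.le) (hadm i h)
  have h1 : (w (sortPerm w (sortPerm w i))).2 = true := by
    have := snd_sortPerm_le hs hb hlt.le hc
    rw [h] at this
    exact top_le_iff.1 this
  exact (ih _ hlt h1).not_gt (sortPerm_lt hs hb hlt hc (h.trans h1.symm))

theorem blockWord_sortPerm {s : Fin n → T} (hs : Monotone s) {w : Fin n → T × Bool}
    (hb : Balanced s w) (hg : LocallyGood s w) : blockWord s (sortPerm w) = w := by
  funext v
  obtain ⟨i, rfl⟩ := (sortPerm w).surjective v
  rw [blockWord_apply]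
  refine Prod.ext (fst_sortPerm hs hb i).symm ?_
  cases h : (w (sortPerm w i)).2
  · simpa using lt_sortPerm_of_barred hs hb hg i h
  · simpa using sortPerm_le_of_unbarred hs hb hg i h

/-- After a fixed point `v`, later `u` in the block satisfy `v < σ u ≤ u`, so by induction they are
fixed as well. Conversely, if `v = σ i` carries an unbarred letter of its own block, then `v ≤ i`;
if `v < i`, downward induction makes `i` fixed, contradicting `σ i = v`. -/
theorem apply_eq_self_iff {s : Fin n → T} (hs : Monotone s) {σ : Equiv.Perm (Fin n)}
    (hσ : BlockIncreasing s σ) (v : Fin n) :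
    σ v = v ↔ ∀ u, v ≤ u → s u = s v → blockWord s σ u = (s u, true) := by
  rw [blockIncreasing_iff hs] at hσ
  have hb := balanced_blockWord s σ
  constructor
  · intro hv
    have hvt : (blockWord s σ (σ v)).2 = true := by rw [blockWord_apply, hv]; simp
    have key : ∀ u, v ≤ u → s u = s v → σ u = u := by
      intro u
      induction u using WellFoundedLT.induction with
      | ind u ih =>
      intro hvu hsu
      rcases hvu.eq_or_lt with rfl | hlt
      · exact hv
      have h1 : (blockWord s σ (σ u)).2 = true := by
        have := snd_sortPerm_le hs hb hvu hsu.symm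
        rw [hσ, hvt] at this
        exact top_le_iff.1 this
      have h2 : σ u ≤ u := by simpa [blockWord_apply] using h1
      have h3 : σ v < σ u := by
        have := sortPerm_lt hs hb hlt hsu.symm (by rw [hσ, hvt, h1])
        rwa [hσ] at this
      rw [hv] at h3
      by_contra hne
      refine hne (σ.injective (ih (σ u) (lt_of_le_of_ne h2 hne) h3.le ?_))
      exact le_antisymm (hsu ▸ hs h2) (hs h3.le)
    intro u hvu hsu
    have := blockWord_apply s σ u
    rw [key u hvu hsu] at this
    simpa using this
  · induction v using WellFoundedGT.induction with
    | ind v ih =>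
    intro h
    obtain ⟨i, hi⟩ := σ.surjective v
    have h1 := h v le_rfl rfl
    rw [← hi, blockWord_apply] at h1
    simp only [Prod.mk.injEq, decide_eq_true_eq, not_lt] at h1
    rw [hi] at h1
    rcases h1.2.eq_or_lt with he | hlt
    · subst he
      exact hi
    · have := ih i hlt fun u hu hsu => h u (hlt.le.trans hu) (hsu.trans h1.1)
      rw [hi] at this
      exact absurd this hlt.ne

open Classical in
/-- The numbers of excedances and of fixed points read off from the associated word. -/
theorem sum_blockIncreasing [Fintype T] {M : Type*} [AddCommMonoid M] {s : Fin n → T}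
    (hs : Monotone s) (F : ℕ → ℕ → M) :
    ∑ σ with BlockIncreasing s σ, F (exc σ) (fix σ) =
      ∑ w with Balanced s w ∧ LocallyGood s w,
        F (Finset.univ.filter fun v => (w v).2 = false).card
          (Finset.univ.filter fun v => ∀ u, v ≤ u → s u = s v → w u = (s u, true)).card := by
  refine Finset.sum_bij' (fun σ _ => blockWord s σ) (fun w _ => sortPerm w) ?_ ?_ ?_ ?_ ?_
  · intro σ _
    simpa using ⟨balanced_blockWord s σ, locallyGood_blockWord hs σ⟩
  · intro w hw
    simp only [Finset.mem_filter, Finset.mem_univ, true_and] at hw ⊢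
    rw [blockIncreasing_iff hs, blockWord_sortPerm hs hw.1 hw.2]
  · intro σ hσ
    exact (blockIncreasing_iff hs σ).1 (by simpa using hσ)
  · intro w hw
    simp only [Finset.mem_filter, Finset.mem_univ, true_and] at hw
    exact blockWord_sortPerm hs hw.1 hw.2
  · intro σ hσ
    congr 1
    · rw [exc]
      refine Finset.card_bij (fun i _ => σ i) ?_ ?_ ?_
      · intro i hi
        simpa [blockWord_apply] using hi
      · intro a _ b _ h
        exact σ.injective h
      · intro v hv
        exact ⟨σ.symm v, by simpa [blockWord] using hv, by simp⟩
    · rw [fix]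
      congr 1
      ext v
      simp only [Finset.mem_filter, Finset.mem_univ, true_and]
      exact apply_eq_self_iff hs (by simpa using hσ) v

end Words

/-! ### Weighted enumeration of the words of one block. -/

section BlockWords

variable {T R : Type*} [LinearOrder T] [CommRing R]

/-- The weight of a letter: `x_d` for the unbarred and `t * x_d` for the barred letter `d`. -/
def letterWeight (t : R) (l : T × Bool) : MvPolynomial T R :=
  MvPolynomial.C (if l.2 then 1 else t) * MvPolynomial.X l.1

/-- The words of the block `c`: all letters are admissible, and the first one is not the barred
letter `c`. -/
def BlockGood {k : ℕ} (c : T) (u : Fin k → T × Bool) : Prop :=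
  ∀ p, Admissible c (u p) ∧ ((p : ℕ) = 0 → u p ≠ (c, false))

open Classical in
/-- The length of the maximal suffix of unbarred letters `c`. -/
def suffixLength {k : ℕ} (c : T) (u : Fin k → T × Bool) : ℕ :=
  (Finset.univ.filter fun p => ∀ q, p ≤ q → u q = (c, true)).card

open Classical in
/-- The weight of a word in the block `c`. -/
def blockWeight (t r : R) {k : ℕ} (c : T) (u : Fin k → T × Bool) : MvPolynomial T R :=
  if BlockGood c u then MvPolynomial.C (r ^ suffixLength c u) * ∏ p, letterWeight t (u p) else 0

theorem blockGood_snoc {k : ℕ} (c : T) (u : Fin k → T × Bool) :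
    BlockGood c (Fin.snoc u (c, true) : Fin (k + 1) → T × Bool) ↔ BlockGood c u := by
  rw [BlockGood, Fin.forall_fin_succ']
  simp [BlockGood, Admissible]

theorem suffixLength_snoc {k : ℕ} (c : T) (u : Fin k → T × Bool) :
    suffixLength c (Fin.snoc u (c, true) : Fin (k + 1) → T × Bool) = suffixLength c u + 1 := by
  classical
  rw [suffixLength, Fin.univ_castSuccEmb, Finset.filter_cons, if_pos, Finset.card_cons,
    Finset.filter_map, Finset.card_map]
  · congr 2
    ext p
    simp [Fin.forall_fin_succ', Fin.le_last]
  · intro q hq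
    rw [Fin.last_le_iff.1 hq]
    simp

theorem suffixLength_eq_zero {k : ℕ} (c : T) (u : Fin (k + 1) → T × Bool)
    (h : u (Fin.last k) ≠ (c, true)) : suffixLength c u = 0 := by
  rw [suffixLength, Finset.card_eq_zero, Finset.filter_eq_empty_iff]
  exact fun p _ hp => h (hp _ (Fin.le_last p))

variable [Fintype T]

open Classical in
theorem sum_letterWeight (t : R) (c : T) :
    ∑ l : T × Bool, (if Admissible c l then letterWeight t l else 0) = letterSum t c := by
  rw [Fintype.sum_prod_type]
  simp only [Fintype.sum_bool, Admissible, letterWeight, if_true, Bool.false_eq_true, if_false]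
  rw [Finset.sum_add_distrib, ← Finset.sum_filter, letterSum, ← Finset.sum_filter,
    add_comm]
  simp [Finset.mul_sum]

open Classical in
-- `P` stands for the first position of the block and `Q` for the last one of a word with empty
-- suffix. Both may hold at once, in a word of length 1.
theorem sum_letterWeight_restrict (t : R) (c : T) (P Q : Prop) [Decidable P] [Decidable Q] :
    ∑ l : T × Bool, (if Admissible c l ∧ (P → l ≠ (c, false)) ∧ (Q → l ≠ (c, true)) then
      letterWeight t l else 0) =
    letterSum t c - (if P then MvPolynomial.C t * MvPolynomial.X c else 0) -
      (if Q then MvPolynomial.X c else 0) := by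
  have h : ∀ l : T × Bool, (if Admissible c l ∧ (P → l ≠ (c, false)) ∧ (Q → l ≠ (c, true)) then
      letterWeight t l else 0) = (if Admissible c l then letterWeight t l else 0) -
      (if l = (c, false) then (if P then MvPolynomial.C t * MvPolynomial.X c else 0) else 0) -
      (if l = (c, true) then (if Q then MvPolynomial.X c else 0) else 0) := by
    intro l
    by_cases h1 : l = (c, false)
    · subst h1
      by_cases P <;> simp_all [Admissible, letterWeight]
    · by_cases h2 : l = (c, true)
      · subst h2
        by_cases Q <;> simp_all [Admissible, letterWeight]
      · simp [h1, h2]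
  rw [Finset.sum_congr rfl fun l _ => h l, Finset.sum_sub_distrib, Finset.sum_sub_distrib,
    sum_letterWeight]
  simp

open Classical in
-- With an empty suffix no power of `r` occurs and the letters are chosen independently.
theorem sum_blockWeight_last_ne (t r : R) (c : T) (k : ℕ) :
    ∑ u : Fin (k + 1) → T × Bool, (if u (Fin.last k) ≠ (c, true) then blockWeight t r c u else 0) =
      ∏ p : Fin (k + 1), (letterSum t c -
        (if (p : ℕ) = 0 then MvPolynomial.C t * MvPolynomial.X c else 0) -
        (if p = Fin.last k then MvPolynomial.X c else 0)) := by
  simp_rw [← sum_letterWeight_restrict]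
  rw [Finset.prod_univ_sum, Fintype.piFinset_univ]
  refine Finset.sum_congr rfl fun u _ => ?_
  rw [Finset.prod_ite_zero]
  by_cases hu : u (Fin.last k) ≠ (c, true)
  · rw [if_pos hu, blockWeight, suffixLength_eq_zero c u hu]
    have : BlockGood c u ↔ ∀ p ∈ Finset.univ, Admissible c (u p) ∧
        ((p : ℕ) = 0 → u p ≠ (c, false)) ∧ (p = Fin.last k → u p ≠ (c, true)) := by
      refine ⟨fun h p _ => ⟨(h p).1, (h p).2, ?_⟩, fun h p => ⟨(h p (by simp)).1,
        (h p (by simp)).2.1⟩⟩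
      rintro rfl
      exact hu
    simp only [this, pow_zero, map_one, one_mul]
    congr
  · rw [if_neg hu, if_neg]
    exact fun h => hu ((h (Fin.last k) (Finset.mem_univ _)).2.2 rfl)

open Classical in
-- Deleting a final unbarred `c` shortens the suffix by one. Even in a word of length 1 it does not
-- interfere with the condition on the first letter, which concerns the barred `c`.
theorem sum_blockWeight_last_eq (t r : R) (c : T) (k : ℕ) :
    ∑ u : Fin (k + 1) → T × Bool, (if u (Fin.last k) = (c, true) then blockWeight t r c u else 0) =
      MvPolynomial.C r * MvPolynomial.X c * ∑ u : Fin k → T × Bool, blockWeight t r c u := by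
  rw [← (Fin.snocEquiv fun _ : Fin (k + 1) => T × Bool).sum_comp, Fintype.sum_prod_type]
  simp only [Fin.snocEquiv, Equiv.coe_fn_mk, Fin.snoc_last]
  rw [Finset.sum_eq_single (c, true) (fun l _ hl => by simp [hl]) (by simp), Finset.mul_sum]
  refine Finset.sum_congr rfl fun u _ => ?_
  rw [if_pos rfl, blockWeight, blockWeight]
  simp only [blockGood_snoc, suffixLength_snoc, Fin.prod_univ_castSucc, Fin.snoc_castSucc,
    Fin.snoc_last]
  split_ifs
  · simp [letterWeight, pow_succ]
    ring
  · simp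

theorem sum_blockWeight (t r : R) (c : T) (k : ℕ) :
    ∑ u : Fin k → T × Bool, blockWeight t r c u = blockPoly t r c k := by
  classical
  have step : ∀ k, ∑ u : Fin (k + 1) → T × Bool, blockWeight t r c u =
      MvPolynomial.C r * MvPolynomial.X c * ∑ u : Fin k → T × Bool, blockWeight t r c u +
      ∏ p : Fin (k + 1), (letterSum t c -
        (if (p : ℕ) = 0 then MvPolynomial.C t * MvPolynomial.X c else 0) -
        (if p = Fin.last k then MvPolynomial.X c else 0)) := by
    intro k
    rw [← sum_blockWeight_last_eq, ← sum_blockWeight_last_ne t r, ← Finset.sum_add_distrib]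
    refine Finset.sum_congr rfl fun u _ => ?_
    by_cases h : u (Fin.last k) = (c, true) <;> simp [h]
  have zero : ∑ u : Fin 0 → T × Bool, blockWeight t r c u = 1 := by
    simp [blockWeight, BlockGood, suffixLength]
  induction k with
  | zero => rw [zero, blockPoly]
  | succ k ih =>
    rw [step, ih]
    cases k with
    | zero => simp [blockPoly]
    | succ k =>
      rw [blockPoly, Fin.prod_univ_succ, Fin.prod_univ_castSucc]
      simp [Fin.ext_iff, Fin.val_succ, fun i : Fin k => (i.isLt.ne)]
      ring

end BlockWords

/-! ### Factorization of the word count over the blocks. -/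

section Factorization

variable {T R : Type*} [LinearOrder T] {n : ℕ} {m : T →₀ ℕ}

/-- The block of a position, for an enumeration `e` of the positions of all blocks. -/
def blockOf (e : Fin n ≃o Σₗ c, Fin (m c)) (v : Fin n) : T := (ofLex (e v)).1

theorem monotone_blockOf (e : Fin n ≃o Σₗ c, Fin (m c)) : Monotone (blockOf e) := by
  intro u v huv
  have h := e.monotone huv
  rcases Sigma.lex_iff.1 h with h | ⟨h, -⟩
  exacts [h.le, h.le]

/-- The position with index `p` in the block `c`. -/
def position (e : Fin n ≃o Σₗ c, Fin (m c)) (c : T) (p : Fin (m c)) : Fin n :=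
  e.symm (toLex ⟨c, p⟩)

theorem blockOf_position (e : Fin n ≃o Σₗ c, Fin (m c)) (c : T) (p : Fin (m c)) :
    blockOf e (position e c p) = c := by
  simp [blockOf, position]

theorem exists_position (e : Fin n ≃o Σₗ c, Fin (m c)) {v : Fin n} {c : T}
    (h : blockOf e v = c) : ∃ p, position e c p = v := by
  subst h
  exact ⟨(ofLex (e v)).2, e.symm_apply_apply v⟩

theorem position_le_iff (e : Fin n ≃o Σₗ c, Fin (m c)) (c : T) (p q : Fin (m c)) :
    position e c p ≤ position e c q ↔ p ≤ q := by
  rw [position, position, e.symm.le_iff_le]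
  refine Sigma.lex_iff.trans ?_
  change (c < c ∨ ∃ _ : c = c, p ≤ q) ↔ _
  simp

theorem position_lt_iff (e : Fin n ≃o Σₗ c, Fin (m c)) (c : T) (p q : Fin (m c)) :
    position e c p < position e c q ↔ p < q := by
  rw [← not_le, ← not_le, position_le_iff]

/-- A word on all positions is a family of words on the blocks. -/
def splitWord (L : Type*) (e : Fin n ≃o Σₗ c, Fin (m c)) :
    (Fin n → L) ≃ ∀ c, Fin (m c) → L :=
  (Equiv.arrowCongr (e.toEquiv.trans ofLex) (Equiv.refl L)).trans
    (Equiv.piCurry fun _ _ => L)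

theorem splitWord_apply {L : Type*} (e : Fin n ≃o Σₗ c, Fin (m c)) (w : Fin n → L) (c : T)
    (p : Fin (m c)) : splitWord L e w c p = w (position e c p) := rfl

theorem locallyGood_iff (e : Fin n ≃o Σₗ c, Fin (m c)) (w : Fin n → T × Bool) :
    LocallyGood (blockOf e) w ↔ ∀ c, BlockGood c (splitWord _ e w c) := by
  -- The global condition of being the first position of a block becomes index 0 within that block.
  have hfirst : ∀ c p, (∀ u < position e c p, blockOf e u ≠ c) ↔ (p : ℕ) = 0 := by
    intro c p
    constructor
    · intro h
      by_contra hp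
      refine h (position e c ⟨0, p.pos⟩) ?_ (blockOf_position e c _)
      rw [position_lt_iff, Fin.lt_def]
      exact Nat.pos_of_ne_zero hp
    · intro hp u hu huc
      obtain ⟨q, rfl⟩ := exists_position e huc
      rw [position_lt_iff, Fin.lt_def] at hu
      omega
  constructor
  · intro h c p
    have := h (position e c p)
    rw [blockOf_position, hfirst] at this
    exact this
  · intro h v
    obtain ⟨p, hp⟩ := exists_position e (v := v) rfl
    have := h (blockOf e v) p
    rw [splitWord_apply, ← hfirst, hp] at this
    exact this

theorem card_blockOf (e : Fin n ≃o Σₗ c, Fin (m c)) (c : T) :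
    (Finset.univ.filter fun v => blockOf e v = c).card = m c := by
  rw [← Fintype.card_fin (m c), ← Finset.card_univ]
  symm
  refine Finset.card_bij (fun p _ => position e c p) ?_ ?_ ?_
  · intro p _
    simp [blockOf_position]
  · intro p _ q _ h
    exact le_antisymm ((position_le_iff e c p q).1 h.le) ((position_le_iff e c q p).1 h.ge)
  · intro v hv
    simp only [Finset.mem_filter, Finset.mem_univ, true_and] at hv
    obtain ⟨p, hp⟩ := exists_position e hv
    exact ⟨p, by simp, hp⟩

variable [CommRing R]

open Classical in
theorem coeff_prod_letterWeight (e : Fin n ≃o Σₗ c, Fin (m c)) (t : R) (w : Fin n → T × Bool) :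
    MvPolynomial.coeff m (∏ v, letterWeight t (w v)) =
      if Balanced (blockOf e) w then t ^ (Finset.univ.filter fun v => (w v).2 = false).card
      else 0 := by
  simp only [letterWeight]
  rw [Finset.prod_mul_distrib, ← map_prod, MvPolynomial.coeff_C_mul]
  have h1 : ∏ v, (MvPolynomial.X (w v).1 : MvPolynomial T R) =
      MvPolynomial.monomial (∑ v, Finsupp.single (w v).1 1) 1 := by
    simp [MvPolynomial.X, MvPolynomial.monomial_sum_one]
  have h2 : ∏ v, (if (w v).2 then 1 else t) =
      t ^ (Finset.univ.filter fun v => (w v).2 = false).card := by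
    rw [← Finset.prod_const, Finset.prod_filter]
    refine Finset.prod_congr rfl fun v _ => ?_
    cases (w v).2 <;> simp
  have h3 : ∑ v, Finsupp.single (w v).1 1 = m ↔ Balanced (blockOf e) w := by
    rw [Finsupp.ext_iff, Balanced]
    refine forall_congr' fun c => ?_
    rw [card_blockOf, Finsupp.finsetSum_apply, Finset.card_filter]
    simp only [Finsupp.single_apply]
  rw [h1, h2, MvPolynomial.coeff_monomial]
  simp only [h3, mul_ite, mul_one, mul_zero]

variable [Fintype T]

open Classical in
theorem card_suffix (e : Fin n ≃o Σₗ c, Fin (m c)) (w : Fin n → T × Bool) :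
    (Finset.univ.filter fun v => ∀ u, v ≤ u → blockOf e u = blockOf e v →
      w u = (blockOf e u, true)).card = ∑ c, suffixLength c (splitWord _ e w c) := by
  rw [Finset.card_eq_sum_card_fiberwise (f := blockOf e) (t := Finset.univ) (by simp)]
  refine Finset.sum_congr rfl fun c _ => ?_
  rw [suffixLength]
  symm
  refine Finset.card_bij (fun p _ => position e c p) ?_ ?_ ?_
  · intro p hp
    simp only [Finset.mem_filter, Finset.mem_univ, true_and, blockOf_position, and_true] at hp ⊢
    intro u hu huc
    obtain ⟨q, rfl⟩ := exists_position e huc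
    rw [position_le_iff] at hu
    rw [blockOf_position]
    exact hp q hu
  · intro p _ q _ h
    exact le_antisymm ((position_le_iff e c p q).1 h.le) ((position_le_iff e c q p).1 h.ge)
  · intro v hv
    simp only [Finset.mem_filter, Finset.mem_univ, true_and] at hv
    obtain ⟨hv, hvc⟩ := hv
    obtain ⟨p, rfl⟩ := exists_position e hvc
    refine ⟨p, ?_, rfl⟩
    simp only [Finset.mem_filter, Finset.mem_univ, true_and]
    intro q hq
    rw [splitWord_apply, hv _ ((position_le_iff e c p q).2 hq) (by simp only [blockOf_position]),
      blockOf_position]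

theorem prod_splitWord {L M : Type*} [CommMonoid M] (e : Fin n ≃o Σₗ c, Fin (m c)) (w : Fin n → L)
    (f : L → M) : ∏ c, ∏ p, f (splitWord L e w c p) = ∏ v, f (w v) := by
  rw [← Fintype.prod_sigma' (fun c p => f (splitWord L e w c p))]
  exact (Fintype.prod_equiv (e.toEquiv.trans ofLex) _ _ fun v => by
    rw [splitWord_apply, position]
    congr 2
    simp).symm

open Classical in
-- `LocallyGood` splits into independent conditions on the blocks. `Balanced` is the only one
-- linking them, and extracting the coefficient of `x^m` imposes it.
theorem sum_words_eq_coeff (e : Fin n ≃o Σₗ c, Fin (m c)) (t r : R) :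
    ∑ w with Balanced (blockOf e) w ∧ LocallyGood (blockOf e) w,
        t ^ (Finset.univ.filter fun v => (w v).2 = false).card *
        r ^ (Finset.univ.filter fun v => ∀ u, v ≤ u → blockOf e u = blockOf e v →
          w u = (blockOf e u, true)).card =
      MvPowerSeries.coeff m (diag (blockPoly t r : T → ℕ → MvPolynomial T R)) := by
  rw [coeff_diag]
  simp_rw [← sum_blockWeight]
  rw [Finset.prod_univ_sum, Fintype.piFinset_univ, ← (splitWord (T × Bool) e).sum_comp,
    MvPolynomial.coeff_sum, Finset.sum_filter]
  refine Finset.sum_congr rfl fun w _ => ?_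
  simp only [blockWeight]
  rw [Finset.prod_ite_zero]
  simp only [Finset.mem_univ, true_imp_iff, ← locallyGood_iff, Finset.prod_mul_distrib,
    prod_splitWord, ← map_prod, Finset.prod_pow_eq_pow_sum, ← card_suffix]
  by_cases hg : LocallyGood (blockOf e) w
  · simp only [hg, and_true, if_true]
    rw [MvPolynomial.coeff_C_mul, coeff_prod_letterWeight e]
    split_ifs
    · exact mul_comm _ _
    · simp
  · simp [hg]

open Classical in
/-- The permutations with increasing blocks, counted by excedances and fixed points. -/
theorem sum_blockIncreasing_eq_coeff (e : Fin n ≃o Σₗ c, Fin (m c)) (t r : R) :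
    ∑ σ with BlockIncreasing (blockOf e) σ, t ^ exc σ * r ^ fix σ =
      MvPowerSeries.coeff m (diag (blockPoly t r : T → ℕ → MvPolynomial T R)) := by
  rw [← sum_words_eq_coeff e]
  exact sum_blockIncreasing (monotone_blockOf e) fun i j => t ^ i * r ^ j

theorem exists_enumeration (m : T →₀ ℕ) : Nonempty (Fin m.degree ≃o Σₗ c, Fin (m c)) := by
  have : Fintype (Σₗ c, Fin (m c)) := inferInstanceAs (Fintype (Σ c, Fin (m c)))
  refine ⟨monoEquivOfFin _ ?_⟩
  rw [Fintype.card_congr (ofLex : (Σₗ c, Fin (m c)) ≃ Σ c, Fin (m c)), Fintype.card_sigma,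
    Finsupp.degree_eq_sum]
  simp

end Factorization

/-! ### Passage to finitely many variables. -/

section Transfer

/-- The part of a series in `t, r` that belongs to the monomial `x^M`. -/
def atMonomial (M : ℕ+ →₀ ℕ) : TRSeries →+ MvPowerSeries (Fin 2) ℚ where
  toFun F := fun e => MvPowerSeries.coeff M (MvPowerSeries.coeff e F)
  map_zero' := rfl
  map_add' _ _ := rfl

theorem coeff_atMonomial (M : ℕ+ →₀ ℕ) (F : TRSeries) (e : Fin 2 →₀ ℕ) :
    MvPowerSeries.coeff e (atMonomial M F) = MvPowerSeries.coeff M (MvPowerSeries.coeff e F) := rfl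

theorem atMonomial_mul (M : ℕ+ →₀ ℕ) (F G : TRSeries) :
    atMonomial M (F * G) = ∑ p ∈ Finset.HasAntidiagonal.antidiagonal M,
      atMonomial p.1 F * atMonomial p.2 G := by
  ext e
  simp only [coeff_atMonomial, MvPowerSeries.coeff_mul, map_sum]
  exact Finset.sum_comm

/-- The series in `t, r` with constant coefficients. -/
def scalar : MvPowerSeries (Fin 2) ℚ →+* TRSeries := MvPowerSeries.map MvPowerSeries.C

theorem atMonomial_scalar_mul_C (M : ℕ+ →₀ ℕ) (p : MvPowerSeries (Fin 2) ℚ) (h : XSeries) :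
    atMonomial M (scalar p * MvPowerSeries.C h) = MvPowerSeries.C (MvPowerSeries.coeff M h) * p := by
  ext e
  rw [coeff_atMonomial, MvPowerSeries.coeff_mul_C, scalar, MvPowerSeries.coeff_map,
    MvPowerSeries.coeff_C_mul, MvPowerSeries.coeff_C_mul, mul_comm]

/-- The coefficient of `x^M z^n` vanishes unless `n` is the degree of `x^M`. -/
def Homogeneous (F : PowerSeries TRSeries) : Prop :=
  ∀ n M, M.degree ≠ n → atMonomial M (PowerSeries.coeff n F) = 0

theorem atMonomial_coeff_mul (n : ℕ) (M : ℕ+ →₀ ℕ) (F G : PowerSeries TRSeries) :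
    atMonomial M (PowerSeries.coeff n (F * G)) =
      ∑ p ∈ Finset.HasAntidiagonal.antidiagonal M, ∑ q ∈ Finset.HasAntidiagonal.antidiagonal n,
        atMonomial p.1 (PowerSeries.coeff q.1 F) * atMonomial p.2 (PowerSeries.coeff q.2 G) := by
  rw [PowerSeries.coeff_mul, map_sum, Finset.sum_comm]
  exact Finset.sum_congr rfl fun q _ => atMonomial_mul _ _ _

theorem Homogeneous.mul {F G : PowerSeries TRSeries} (hF : Homogeneous F) (hG : Homogeneous G) :
    Homogeneous (F * G) := by
  intro n M hM
  rw [atMonomial_coeff_mul]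
  refine Finset.sum_eq_zero fun p hp => Finset.sum_eq_zero fun q hq => ?_
  rw [Finset.HasAntidiagonal.mem_antidiagonal] at hp hq
  by_cases h1 : p.1.degree = q.1
  · rw [hG q.2 p.2, mul_zero]
    rintro h2
    apply hM
    rw [← hp, ← hq, map_add, h1, h2]
  · rw [hF q.1 p.1 h1, zero_mul]

theorem Homogeneous.sub {F G : PowerSeries TRSeries} (hF : Homogeneous F) (hG : Homogeneous G) :
    Homogeneous (F - G) := by
  intro n M hM
  rw [map_sub, map_sub, hF n M hM, hG n M hM, sub_zero]

theorem atMonomial_coeff_rescale_H (p : MvPowerSeries (Fin 2) ℚ) (n : ℕ) (M : ℕ+ →₀ ℕ) :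
    atMonomial M (PowerSeries.coeff n (PowerSeries.rescale (scalar p) H)) =
      if M.degree = n then p ^ n else 0 := by
  rw [PowerSeries.coeff_rescale, H, PowerSeries.coeff_mk, ← map_pow, atMonomial_scalar_mul_C]
  change MvPowerSeries.C (if M.degree = n then 1 else 0) * _ = _
  split_ifs <;> simp

theorem atMonomial_coeff_C (p : MvPowerSeries (Fin 2) ℚ) (n : ℕ) (M : ℕ+ →₀ ℕ) :
    atMonomial M (PowerSeries.coeff n (PowerSeries.C (scalar p))) =
      if n = 0 ∧ M = 0 then p else 0 := by
  classical
  rw [PowerSeries.coeff_C]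
  by_cases hn : n = 0
  · have := atMonomial_scalar_mul_C M p 1
    rw [map_one, mul_one, MvPowerSeries.coeff_one] at this
    rw [if_pos hn, this]
    by_cases hM : M = 0 <;> simp [hn, hM]
  · simp [hn]

theorem homogeneous_rescale_H (p : MvPowerSeries (Fin 2) ℚ) :
    Homogeneous (PowerSeries.rescale (scalar p) H) := fun n M hM => by
  rw [atMonomial_coeff_rescale_H, if_neg hM]

theorem homogeneous_C (p : MvPowerSeries (Fin 2) ℚ) :
    Homogeneous (PowerSeries.C (scalar p)) := fun n M hM => by
  rw [atMonomial_coeff_C, if_neg]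
  rintro ⟨rfl, rfl⟩
  exact hM (map_zero _)

variable {T : Type*}

/-- The series in the variables `x_{f c}` obtained from a homogeneous series by setting the other
variables to zero and `z = 1`. -/
def restrict (f : T → ℕ+) : PowerSeries TRSeries →+ MvPowerSeries T (MvPowerSeries (Fin 2) ℚ) where
  toFun F := fun m => atMonomial (m.mapDomain f) (PowerSeries.coeff m.degree F)
  map_zero' := by
    funext m
    rw [map_zero, map_zero]
    rfl
  map_add' F G := by
    funext m
    rw [map_add, map_add]
    rfl

theorem coeff_restrict (f : T → ℕ+) (F : PowerSeries TRSeries) (m : T →₀ ℕ) :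
    MvPowerSeries.coeff m (restrict f F) =
      atMonomial (m.mapDomain f) (PowerSeries.coeff m.degree F) := rfl

theorem degree_mapDomain (f : T → ℕ+) (m : T →₀ ℕ) : (m.mapDomain f).degree = m.degree := by
  rw [Finsupp.degree_apply, Finsupp.degree_apply]
  exact Finsupp.sum_mapDomain_index (h := fun _ k => k) (fun _ => rfl) fun _ _ _ => rfl

/-- Exponents are nonnegative, so both summands of a vector supported on the range of `f` are
supported there. -/
theorem sum_antidiagonal_mapDomain {A : Type*} [AddCommMonoid A] {f : T → ℕ+}
    (hf : Function.Injective f) (m : T →₀ ℕ) [Finset.HasAntidiagonal (T →₀ ℕ)]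
    (G : (ℕ+ →₀ ℕ) × (ℕ+ →₀ ℕ) → A) :
    ∑ p ∈ Finset.HasAntidiagonal.antidiagonal (m.mapDomain f), G p =
      ∑ p ∈ Finset.HasAntidiagonal.antidiagonal m, G (p.1.mapDomain f, p.2.mapDomain f) := by
  have hinj := Finsupp.mapDomain_injective (M := ℕ) hf
  symm
  refine Finset.sum_nbij (fun p => (p.1.mapDomain f, p.2.mapDomain f)) ?_ ?_ ?_ fun _ _ => rfl
  · intro p hp
    rw [Finset.HasAntidiagonal.mem_antidiagonal] at hp ⊢
    rw [← hp, Finsupp.mapDomain_add]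
  · intro p _ q _ h
    rw [Prod.mk.injEq] at h
    exact Prod.ext (hinj h.1) (hinj h.2)
  · rintro ⟨a, b⟩ h
    rw [Finset.mem_coe, Finset.HasAntidiagonal.mem_antidiagonal] at h
    have hr : ∀ x, (m.mapDomain f) x ≠ 0 → x ∈ Set.range f := fun x hx => by
      by_contra hn
      exact hx (Finsupp.mapDomain_of_notMem_range _ _ hn)
    have ha : (a.comapDomain f hf.injOn).mapDomain f = a :=
      Finsupp.mapDomain_comapDomain f hf a fun x hx => hr x fun h0 => by
        rw [← h] at h0
        exact Finsupp.mem_support_iff.1 hx (Nat.eq_zero_of_add_eq_zero_right h0)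
    have hb : (b.comapDomain f hf.injOn).mapDomain f = b :=
      Finsupp.mapDomain_comapDomain f hf b fun x hx => hr x fun h0 => by
        rw [← h] at h0
        exact Finsupp.mem_support_iff.1 hx (Nat.eq_zero_of_add_eq_zero_left h0)
    refine ⟨(a.comapDomain f hf.injOn, b.comapDomain f hf.injOn), ?_, by simp [ha, hb]⟩
    rw [Finset.mem_coe, Finset.HasAntidiagonal.mem_antidiagonal]
    apply hinj
    rw [Finsupp.mapDomain_add, ha, hb]
    exact h

/-- By homogeneity each splitting of the monomial leaves only one splitting of the power of `z`, so
setting `z = 1` is multiplicative. -/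
theorem restrict_mul {f : T → ℕ+} (hf : Function.Injective f) {F G : PowerSeries TRSeries}
    (hF : Homogeneous F) (hG : Homogeneous G) :
    restrict f (F * G) = restrict f F * restrict f G := by
  classical
  ext1 m
  rw [coeff_restrict, atMonomial_coeff_mul, MvPowerSeries.coeff_mul,
    sum_antidiagonal_mapDomain hf]
  refine Finset.sum_congr rfl fun p hp => ?_
  rw [Finset.HasAntidiagonal.mem_antidiagonal] at hp
  rw [Finset.sum_eq_single (p.1.degree, p.2.degree)]
  · rfl
  · rintro ⟨i, j⟩ hij hne
    rw [Finset.HasAntidiagonal.mem_antidiagonal] at hij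
    by_cases h1 : p.1.degree = i
    · rw [hG j, mul_zero]
      rw [degree_mapDomain]
      rintro rfl
      exact hne (by rw [h1])
    · rw [hF i, zero_mul]
      rwa [degree_mapDomain]
  · intro h
    rw [Finset.HasAntidiagonal.mem_antidiagonal] at h
    exact absurd (by rw [← hp, map_add]) h

theorem restrict_rescale_H [Fintype T] (f : T → ℕ+) (p : MvPowerSeries (Fin 2) ℚ) :
    restrict f (PowerSeries.rescale (scalar p) H) = geomSeries T p := by
  ext1 m
  rw [coeff_restrict, atMonomial_coeff_rescale_H, if_pos (degree_mapDomain f m), geomSeries,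
    coeff_prodSeries, Finset.prod_pow_eq_pow_sum, Finsupp.degree_eq_sum]

theorem restrict_C (f : T → ℕ+) (p : MvPowerSeries (Fin 2) ℚ) :
    restrict f (PowerSeries.C (scalar p)) = MvPowerSeries.C p := by
  classical
  ext1 m
  rw [coeff_restrict, atMonomial_coeff_C, MvPowerSeries.coeff_C]
  refine if_congr ⟨fun h => ?_, ?_⟩ rfl rfl
  · exact (Finsupp.degree_eq_zero_iff m).1 h.1
  · rintro rfl
    simp

theorem eq_of_restrict_eq {F G : PowerSeries TRSeries} (hF : Homogeneous F) (hG : Homogeneous G)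
    (h : ∀ (T : Type) [LinearOrder T] [Fintype T] (f : T → ℕ+), StrictAnti f →
      restrict f F = restrict f G) : F = G := by
  have key : ∀ n M, atMonomial M (PowerSeries.coeff n F) = atMonomial M (PowerSeries.coeff n G) := by
    intro n M
    by_cases hM : M.degree = n
    · let f : (M.support)ᵒᵈ → ℕ+ := fun c => (OrderDual.ofDual c : M.support)
      have hf : StrictAnti f := fun a b hab => hab
      have hm : (M.comapDomain f hf.injective.injOn).mapDomain f = M :=
        Finsupp.mapDomain_comapDomain f hf.injective M fun x hx =>
          ⟨OrderDual.toDual ⟨x, hx⟩, rfl⟩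
      have := congrArg (MvPowerSeries.coeff (M.comapDomain f hf.injective.injOn))
        (h _ f hf)
      rw [coeff_restrict, coeff_restrict, ← degree_mapDomain f, hm, hM] at this
      exact this
    · rw [hF n M hM, hG n M hM]
  ext n e M
  exact congrArg (MvPowerSeries.coeff e) (key n M)

end Transfer

/-! ### Coefficients of the fundamental quasisymmetric functions. -/

section Fundamental

theorem content_apply {n : ℕ} (s : Fin n → ℕ+) (c : ℕ+) :
    content s c = (Finset.univ.filter fun a => s a = c).card := by
  rw [content, Finsupp.finsetSum_apply, Finset.card_filter]
  simp only [Finsupp.single_apply]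

theorem degree_content {n : ℕ} (s : Fin n → ℕ+) : (content s).degree = n := by
  rw [content, map_sum]
  simp

theorem barWord_injective {n : ℕ} (σ : Equiv.Perm (Fin n)) : Function.Injective (barWord σ) := by
  intro a b h
  simp only [barWord] at h
  split_ifs at h <;> simp at h <;> exact h

variable {T : Type*} [LinearOrder T] {n : ℕ}

theorem blockIncreasing_of_succ {s : Fin n → T} (hs : Monotone s) {σ : Equiv.Perm (Fin n)}
    (h : ∀ a b : Fin n, (b : ℕ) = a + 1 → s a = s b → barWord σ a < barWord σ b) :
    BlockIncreasing s σ := by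
  have key : ∀ k : ℕ, ∀ i j : Fin n, (j : ℕ) = i + k + 1 → s i = s j →
      barWord σ i < barWord σ j := by
    intro k
    induction k with
    | zero => exact h
    | succ k ih =>
      intro i j hj hij
      let l : Fin n := ⟨i + k + 1, by have := j.isLt; omega⟩
      have h1 : i ≤ l := by rw [Fin.le_def]; simp only [l]; omega
      have h2 : l ≤ j := by rw [Fin.le_def]; simp only [l]; omega
      have h3 : s i = s l := le_antisymm (hs h1) (hij ▸ hs h2)
      exact (ih i l rfl h3).trans (h l j (by simp only [l]; omega) (h3.symm.trans hij))
  intro i j hij he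
  exact key (j - i - 1) i j (by rw [Fin.lt_def] at hij; omega) he

/-- Compatibility forbids a descent of `σ̄` between neighbours with equal index. The letters of `σ̄`
are distinct, so this means a strict increase along each block. -/
theorem isCompatible_iff {f : T → ℕ+} (hf : StrictAnti f) {s : Fin n → T} (hs : Monotone s)
    (σ : Equiv.Perm (Fin n)) : IsCompatible (exd σ) (f ∘ s) ↔ BlockIncreasing s σ := by
  have hexd : ∀ a b : Fin n, (b : ℕ) = a + 1 →
      ((a : ℕ) + 1 ∈ exd σ ↔ barWord σ b < barWord σ a) := by
    intro a b hab
    constructor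
    · rintro ⟨a', b', h1, h2, h3⟩
      obtain rfl : a' = a := Fin.ext (by omega)
      obtain rfl : b' = b := Fin.ext (by omega)
      exact h3
    · intro h
      exact ⟨a, b, rfl, hab, h⟩
  constructor
  · rintro ⟨-, h⟩
    refine blockIncreasing_of_succ hs fun a b hab he => ?_
    have hne : barWord σ a ≠ barWord σ b := fun h' => by
      have := barWord_injective σ h'
      subst this
      omega
    refine lt_of_le_of_ne (not_lt.1 fun hlt => ?_) hne
    have := h a b hab ((hexd a b hab).2 hlt)
    simp [he] at this
  · intro h
    refine ⟨hf.antitone.comp_monotone hs, fun a b hab hmem => ?_⟩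
    refine hf (lt_of_le_of_ne (hs ?_) fun he => ?_)
    · rw [Fin.le_def]; omega
    · exact (h a b (by rw [Fin.lt_def]; omega) he).not_gt ((hexd a b hab).1 hmem)

theorem content_comp_blockOf {m : T →₀ ℕ} (e : Fin n ≃o Σₗ c, Fin (m c)) {f : T → ℕ+} :
    content (f ∘ blockOf e) = m.mapDomain f := by
  have : m = ∑ v, Finsupp.single (blockOf e v) 1 := by
    ext c
    rw [← card_blockOf e, Finsupp.finsetSum_apply, Finset.card_filter]
    simp only [Finsupp.single_apply]
  conv_rhs => rw [this, Finsupp.mapDomain_finsetSum]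
  simp [content]

open Classical in
theorem coeff_fundamental {m : T →₀ ℕ} (e : Fin n ≃o Σₗ c, Fin (m c)) {f : T → ℕ+}
    (hf : StrictAnti f) (σ : Equiv.Perm (Fin n)) :
    MvPowerSeries.coeff (m.mapDomain f) (fundamental (exd σ) n) =
      if BlockIncreasing (blockOf e) σ then 1 else 0 := by
  have huniq : ∀ s : Fin n → ℕ+, Antitone s → content s = m.mapDomain f → s = f ∘ blockOf e := by
    intro s hs hc
    -- Weakly decreasing sequences are monotone into the order dual, and there the content
    -- determines them.
    refine monotone_eq_of_card_fiber_eq (T := ℕ+ᵒᵈ) (f := s) (g := f ∘ blockOf e) hs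
      (hf.antitone.comp_monotone (monotone_blockOf e)) fun c => ?_
    have := DFunLike.congr_fun (hc.trans (content_comp_blockOf e (f := f)).symm) c
    exact (content_apply s c).symm.trans (this.trans (content_apply _ c))
  change ((Set.ncard _ : ℕ) : ℚ) = _
  split_ifs with h
  · have : {s : Fin n → ℕ+ | IsCompatible (exd σ) s ∧ content s = m.mapDomain f} =
        {f ∘ blockOf e} := by
      ext s
      constructor
      · rintro ⟨h1, h2⟩
        exact huniq s h1.1 h2
      · rintro rfl
        exact ⟨(isCompatible_iff hf (monotone_blockOf e) σ).2 h, content_comp_blockOf e⟩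
    rw [this, Set.ncard_singleton, Nat.cast_one]
  · have : {s : Fin n → ℕ+ | IsCompatible (exd σ) s ∧ content s = m.mapDomain f} = ∅ := by
      refine Set.eq_empty_of_forall_notMem ?_
      rintro s ⟨h1, h2⟩
      obtain rfl := huniq s h1.1 h2
      exact h ((isCompatible_iff hf (monotone_blockOf e) σ).1 h1)
    rw [this, Set.ncard_empty, Nat.cast_zero]

theorem coeff_genQ (n : ℕ) (e : Fin 2 →₀ ℕ) :
    MvPowerSeries.coeff e (PowerSeries.coeff n genQ) = Q n (e 0) (e 1) := by
  exact DFunLike.congr_arg (MvPowerSeries.coeff e) (PowerSeries.coeff_mk n _)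

theorem homogeneous_genQ : Homogeneous genQ := by
  intro n M hM
  ext e
  rw [coeff_atMonomial, coeff_genQ, Q, map_sum, map_zero (MvPowerSeries.coeff e)]
  refine Finset.sum_eq_zero fun σ _ => ?_
  change ((Set.ncard _ : ℕ) : ℚ) = 0
  have : {s : Fin n → ℕ+ | IsCompatible (exd σ) s ∧ content s = M} = ∅ := by
    refine Set.eq_empty_of_forall_notMem ?_
    rintro s ⟨-, rfl⟩
    exact hM (degree_content s)
  rw [this, Set.ncard_empty, Nat.cast_zero]

theorem restrict_genQ [Fintype T] {f : T → ℕ+} (hf : StrictAnti f) :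
    restrict f genQ = diag (blockPoly (MvPowerSeries.X 0) (MvPowerSeries.X 1)) := by
  classical
  ext m e
  obtain ⟨E⟩ := exists_enumeration m
  rw [← sum_blockIncreasing_eq_coeff E, coeff_restrict, coeff_atMonomial, coeff_genQ, Q, map_sum,
    map_sum, Finset.sum_filter, Finset.sum_filter]
  refine Finset.sum_congr rfl fun σ _ => ?_
  rw [coeff_fundamental E hf]
  have hX : (MvPowerSeries.X 0 ^ exc σ * MvPowerSeries.X 1 ^ fix σ : MvPowerSeries (Fin 2) ℚ) =
      MvPowerSeries.monomial (Finsupp.single 0 (exc σ) + Finsupp.single 1 (fix σ)) 1 := by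
    rw [MvPowerSeries.X_pow_eq, MvPowerSeries.X_pow_eq, MvPowerSeries.monomial_mul_monomial,
      one_mul]
  have he : e = Finsupp.single 0 (exc σ) + Finsupp.single 1 (fix σ) ↔
      exc σ = e 0 ∧ fix σ = e 1 := by
    rw [Finsupp.ext_iff, Fin.forall_fin_two]
    simp [eq_comm]
  rw [hX, MvPowerSeries.coeff_monomial]
  simp only [he]
  split_ifs <;> rfl

end Fundamental

/-! ### The two quotients. -/

section Conclusion

theorem t_eq_scalar : t = scalar (MvPowerSeries.X 0) := by
  rw [t, scalar, MvPowerSeries.map_X]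

theorem r_eq_scalar : r = scalar (MvPowerSeries.X 1) := by
  rw [r, scalar, MvPowerSeries.map_X]

theorem den₁_eq : den₁ = PowerSeries.rescale (scalar (MvPowerSeries.X 0)) H -
    PowerSeries.C (scalar (MvPowerSeries.X 0)) * PowerSeries.rescale (scalar 1) H := by
  rw [den₁, t_eq_scalar, map_one scalar, PowerSeries.rescale_one]
  rfl

theorem genQ_mul_den₁ : genQ * den₁ = PowerSeries.C (1 - t) * PowerSeries.rescale r H := by
  have hC : (1 - t : TRSeries) = scalar (1 - MvPowerSeries.X 0) := by
    rw [map_sub, map_one, t_eq_scalar]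
  rw [hC, r_eq_scalar, den₁_eq]
  have hH := homogeneous_rescale_H
  have hd := (hH (MvPowerSeries.X 0)).sub ((homogeneous_C (MvPowerSeries.X 0)).mul (hH 1))
  refine eq_of_restrict_eq (homogeneous_genQ.mul hd) ((homogeneous_C _).mul (hH _)) ?_
  intro T _ _ f hf
  rw [restrict_mul hf.injective homogeneous_genQ hd, map_sub,
    restrict_mul hf.injective (homogeneous_C _) (hH _),
    restrict_mul hf.injective (homogeneous_C _) (hH _), restrict_genQ hf]
  simp only [restrict_rescale_H, restrict_C]
  exact diag_blockPoly_mul _ _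

theorem hsym_zero : hsym 0 = 1 := by
  classical
  ext m
  rw [MvPowerSeries.coeff_one]
  change (if m.degree = 0 then (1 : ℚ) else 0) = _
  simp only [Finsupp.degree_eq_zero_iff]

/-- The coefficient of `z^n` in `den₁` is `(t^n - t) h_n`: it is `1 - t` for `n = 0`, vanishes for
`n = 1`, and equals `-(1 - t) t [n-1]_t h_n` for `n ≥ 2`. -/
theorem den₁_eq_mul_den₂ : den₁ = PowerSeries.C (1 - t) * den₂ := by
  ext1 n
  rw [den₁, den₂, PowerSeries.coeff_C_mul, map_sub, map_sub, PowerSeries.coeff_rescale,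
    PowerSeries.coeff_C_mul, H, PowerSeries.coeff_mk, PowerSeries.coeff_mk, PowerSeries.coeff_one]
  match n with
  | 0 => simp [hsym_zero]
  | 1 => simp
  | n + 2 =>
    have h : (1 - t) * qnum (n + 1) = 1 - t ^ (n + 1) := mul_neg_geom_sum t (n + 1)
    simp only [Nat.le_add_left, if_true, Nat.add_one_ne_zero, if_false,
      show n + 2 - 1 = n + 1 from rfl]
    linear_combination (t * MvPowerSeries.C (hsym (n + 2))) * h

theorem isUnit_den₂ : IsUnit den₂ := by
  rw [PowerSeries.isUnit_iff_constantCoeff]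
  rw [← PowerSeries.coeff_zero_eq_constantCoeff_apply, den₂, map_sub, PowerSeries.coeff_mk]
  simp

theorem isUnit_one_sub_t : IsUnit (1 - t) := by
  rw [MvPowerSeries.isUnit_iff_constantCoeff]
  simp [t]

theorem isUnit_den₁ : IsUnit den₁ := by
  rw [den₁_eq_mul_den₂]
  exact (isUnit_one_sub_t.map PowerSeries.C).mul isUnit_den₂

end Conclusion

end EulerianQSym

end

/-- The two denominators are invertible formal power series, and the generating function of
the `Q_{n,j,k}` equals both quotients. -/
theorem theorem1p2 :
    IsUnit EulerianQSym.den₁ ∧ IsUnit EulerianQSym.den₂ ∧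
    EulerianQSym.genQ =
      PowerSeries.C (1 - EulerianQSym.t) * PowerSeries.rescale EulerianQSym.r EulerianQSym.H *
        Ring.inverse EulerianQSym.den₁ ∧
    PowerSeries.C (1 - EulerianQSym.t) * PowerSeries.rescale EulerianQSym.r EulerianQSym.H *
        Ring.inverse EulerianQSym.den₁ =
      PowerSeries.rescale EulerianQSym.r EulerianQSym.H * Ring.inverse EulerianQSym.den₂ := by
  have h1 := EulerianQSym.isUnit_den₁
  have h2 := EulerianQSym.isUnit_den₂
  refine ⟨h1, h2, ?_, ?_⟩
  · rw [← EulerianQSym.genQ_mul_den₁, mul_assoc, Ring.mul_inverse_cancel _ h1, mul_one]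
  · have e1 := Ring.mul_inverse_cancel _ h1
    have e2 := Ring.mul_inverse_cancel _ h2
    have e3 := EulerianQSym.den₁_eq_mul_den₂
    linear_combination (- PowerSeries.C (1 - EulerianQSym.t) *
      PowerSeries.rescale EulerianQSym.r EulerianQSym.H * Ring.inverse EulerianQSym.den₁) * e2 +
      (PowerSeries.rescale EulerianQSym.r EulerianQSym.H * Ring.inverse EulerianQSym.den₂) * e1 -
      (PowerSeries.rescale EulerianQSym.r EulerianQSym.H * Ring.inverse EulerianQSym.den₂ *
        Ring.inverse EulerianQSym.den₁) * e3
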